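/- Let $X$ be a Hausdorff real locally convex space, let $p\in S\subset X$, and let $S$ be compact and star-shaped with respect to $p$, i.e. $\lambda x+(1-\lambda)p\in S$ for all $x\in S$ and $\lambda\in[0,1]$. Let $C=\overline{\mathrm{co}}(S)$ be the closed convex hull of $S$. For $A\in\{S,C\}$ and $x\in X$ put $$\rho_{A,p}(x)=\inf\{r>0: x-p\in r(A-p)\}\in[0,\infty],\qquad \inf\emptyset=\infty,$$ and let $$\alpha_p=\inf_{x\in C}\frac{\rho_{C,p}(x)}{\rho_{S,p}(x)}$$ be the convexity index of $S$ with respect to $p$, where the quotient is read as $0$ if $\rho_{S,p}(x)=\infty$ and as $1$ if $\rho_{C,p}(x)=\rho_{S,p}(x)=0$ (in particular for $x=p$); then $\alpha_p\in[0,1]$. Suppose that $\alpha_p>0$. Then every continuous map $f:S\to S$ has at least one of the following two properties: (a) $f(p)=p$; (b) there is an injective map $\lambda\mapsto x_\lambda$ from $(0,1]$ into $S$ such that, for every $\lambda\in(0,1]$, $$f(x_\lambda)=p+\frac{1}{\lambda\alpha_p}(x_\lambda-p).$$ -/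

import Mathlib

open scoped ENNReal

noncomputable section

/-- The extended real-valued function `ρ_{S,p}` generated by `S - p`:
`ρ_{S,p}(x) = inf {r > 0 : x - p ∈ r (S - p)}`, with `inf ∅ = ∞`. -/
def starGauge {X : Type*} [AddCommGroup X] [Module ℝ X] (S : Set X) (p x : X) : ℝ≥0∞ :=
  sInf {t : ℝ≥0∞ | ∃ r : ℝ, 0 < r ∧ (∃ y ∈ S, x - p = r • (y - p)) ∧ t = ENNReal.ofReal r}

/-- Quotient of extended nonnegative numbers with the convention `0 / 0 = 1` (Mathlib's
`0 / 0` is `0`); as in Mathlib, `a / ∞ = 0`, and `a / 0 = ∞` for `a ≠ 0`. -/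
def extRatio (a b : ℝ≥0∞) : ℝ≥0∞ :=
  if a = 0 ∧ b = 0 then 1 else a / b

/-- The convexity index of `S` with respect to `p`: the infimum over `x ∈ C` of
`ρ_{C,p}(x) / ρ_{S,p}(x)`, where `C` is the closed convex hull of `S`. The convention for `0 / 0`
concerns the point `x = p`, where both functions vanish; the value `1` there never lowers the
infimum, since the quotient is at most `1` whenever `S` is bounded and `x ≠ p`, and it gives a
one-point set the index `1`. -/
def convexityIndex {X : Type*} [AddCommGroup X] [Module ℝ X] [TopologicalSpace X]
    (S : Set X) (p : X) : ℝ≥0∞ :=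
  ⨅ x ∈ closure (convexHull ℝ S),
    extRatio (starGauge (closure (convexHull ℝ S)) p x) (starGauge S p x)

theorem starGauge_self {X : Type*} [AddCommGroup X] [Module ℝ X] {S : Set X} {p : X}
    (hp : p ∈ S) : starGauge S p p = 0 := by
  refine le_antisymm (ENNReal.le_of_forall_pos_le_add fun ε hε _ => ?_) bot_le
  rw [zero_add]
  exact sInf_le ⟨(ε : ℝ), by exact_mod_cast hε, ⟨p, hp, by simp⟩, by simp⟩

/-- The convexity index is at most `1`, so passing to its real value loses nothing. -/
theorem convexityIndex_le_one {X : Type*} [AddCommGroup X] [Module ℝ X] [TopologicalSpace X]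
    {S : Set X} {p : X} (hp : p ∈ S) : convexityIndex S p ≤ 1 := by
  have hC : p ∈ closure (convexHull ℝ S) := subset_closure (subset_convexHull ℝ S hp)
  refine (iInf₂_le p hC).trans ?_
  simp [extRatio, starGauge_self hp, starGauge_self hC]

end

/-!
Write `α` for the convexity index and `C` for the closed convex hull of `S`, and take `p = 0`. On
`C` the gauge of `C` is at most `1`, so the gauge of `S` is at most `1 / α`; as `S` is closed and
star-shaped, this means `α C ⊆ S` (`add_smul_sub_mem_of_mem_closure_convexHull`). In particular `C`,
being a closed subset of `(1 / α) S`, is compact. For `t ∈ (0, 1]` the map `y ↦ f (t α y)` is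
therefore a continuous self-map of the compact convex set `C`, and it has a fixed point `y` by the
Schauder–Tychonoff theorem (`exists_fixedPoint_of_isCompact_convex`). The point `x = t α y` of `S`
satisfies `f x = x / (t α)`. If the same `x` serves two values of `t`, then `x = 0` and `f 0 = 0`.

The Schauder–Tychonoff theorem is reduced to Brouwer's theorem on a simplex by Schauder projections,
and that one to the Euclidean ball by retracting onto the simplex. Brouwer's theorem on the ball is
proved by the volume argument of Milnor and Rogers. A smooth self-map without fixed points yields a
`C¹` retraction `r` onto the sphere. The maps `id + t (r - id)` permute the open ball for small `t`,
so the integral of their Jacobian determinant, a polynomial in `t`, equals the volume of the ball for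
small `t` and hence for `t = 1`. But the Jacobian determinant of `r` vanishes
(`not_contDiffAt_retraction`). That the integral is polynomial in `t` is used through Lagrange
interpolation of `det (1 + t A)` with weights independent of `A`
(`exists_sum_mul_det_eq_det_one_add`).
-/


/-! ### Nonexistence of a smooth retraction onto the sphere -/

section NoRetraction

open Set Metric MeasureTheory Polynomial NNReal

variable {E : Type*} [NormedAddCommGroup E] [InnerProductSpace ℝ E]

theorem exists_polynomial_det_one_add_smul (b : Module.Basis (Fin (Module.finrank ℝ E)) ℝ E)
    (A : E →L[ℝ] E) :
    ∃ q : ℝ[X], q.natDegree ≤ Module.finrank ℝ E ∧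
      ∀ t : ℝ, q.eval t = (ContinuousLinearMap.id ℝ E + t • A).det := by
  refine ⟨Matrix.det ((X : ℝ[X]) • (LinearMap.toMatrix b b A.toLinearMap).map C +
    (1 : Matrix (Fin (Module.finrank ℝ E)) (Fin (Module.finrank ℝ E)) ℝ).map C), ?_, fun t => ?_⟩
  · simpa using natDegree_det_X_add_C_le (LinearMap.toMatrix b b A.toLinearMap) 1
  · rw [ContinuousLinearMap.det, ← LinearMap.det_toMatrix b, ← coe_evalRingHom,
      RingHom.map_det]
    congr 1
    ext i j
    simp [Matrix.one_apply, LinearMap.toMatrix_apply, Finsupp.single_apply, eq_comm, add_comm]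
    split_ifs <;> simp [mul_comm]

/-- A segment leaving the open unit ball crosses the unit sphere. -/
theorem exists_mem_segment_norm_eq_one {x y : E} (hx : x ∈ ball (0 : E) 1)
    (hy : y ∉ ball (0 : E) 1) : ∃ z, ‖z‖ = 1 ∧ ‖x - z‖ ≤ ‖x - y‖ := by
  have hc : Continuous fun s : ℝ => ‖x + s • (y - x)‖ := by fun_prop
  obtain ⟨s, hs, hsz⟩ := intermediate_value_Icc (zero_le_one (α := ℝ)) hc.continuousOn
    (show (1 : ℝ) ∈ Icc _ _ by simp at hx hy ⊢; exact ⟨hx.le, hy⟩)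
  refine ⟨_, hsz, ?_⟩
  rw [sub_add_cancel_left, norm_neg, norm_smul, Real.norm_of_nonneg hs.1, norm_sub_rev x y]
  exact mul_le_of_le_one_left (norm_nonneg _) hs.2

/-- Extension by zero from the ball keeps the Lipschitz constant: a segment leaving the ball meets
the sphere, where the map vanishes. -/
theorem lipschitzWith_indicator_ball {k : E → E} {L : ℝ≥0}
    (hk : LipschitzOnWith L k (closedBall 0 1)) (h0 : ∀ x, ‖x‖ = 1 → k x = 0) :
    LipschitzWith L ((ball (0 : E) 1).indicator k) := by
  have key : ∀ x ∈ ball (0 : E) 1, ∀ y ∉ ball (0 : E) 1, ‖k x‖ ≤ L * ‖x - y‖ := by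
    intro x hx y hy
    obtain ⟨z, hz, hxz⟩ := exists_mem_segment_norm_eq_one hx hy
    have := hk.norm_sub_le (ball_subset_closedBall hx) (show z ∈ closedBall (0 : E) 1 by simp [hz])
    rw [h0 z hz, sub_zero] at this
    exact this.trans (by gcongr)
  refine LipschitzWith.of_dist_le_mul fun x y => ?_
  rw [dist_eq_norm, dist_eq_norm]
  by_cases hx : x ∈ ball (0 : E) 1 <;> by_cases hy : y ∈ ball (0 : E) 1
  · rw [indicator_of_mem hx, indicator_of_mem hy]
    exact hk.norm_sub_le (ball_subset_closedBall hx) (ball_subset_closedBall hy)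
  · rw [indicator_of_mem hx, indicator_of_notMem hy, sub_zero]
    exact key x hx y hy
  · rw [indicator_of_notMem hx, indicator_of_mem hy, zero_sub, norm_neg, norm_sub_rev x y]
    exact key y hy x hx
  · rw [indicator_of_notMem hx, indicator_of_notMem hy, sub_zero, norm_zero]
    positivity

variable [FiniteDimensional ℝ E]

/-- Lagrange interpolation at the nodes `v i` of the polynomial `t ↦ det (1 + t A)`, evaluated at
`t = 1`. The coefficients `c i` do not depend on `A`. -/
theorem exists_sum_mul_det_eq_det_one_add (v : ℕ → ℝ) (hv : Function.Injective v) :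
    ∃ c : ℕ → ℝ, ∀ A : E →L[ℝ] E, (ContinuousLinearMap.id ℝ E + A).det =
      ∑ i ∈ Finset.range (Module.finrank ℝ E + 1),
        c i * (ContinuousLinearMap.id ℝ E + v i • A).det := by
  refine ⟨fun i => (Lagrange.basis (Finset.range (Module.finrank ℝ E + 1)) v i).eval 1,
    fun A => ?_⟩
  obtain ⟨q, hq, hqe⟩ := exists_polynomial_det_one_add_smul (Module.finBasis ℝ E) A
  have h := Lagrange.eq_interpolate (f := q) (s := Finset.range (Module.finrank ℝ E + 1)) (v := v)
    hv.injOn (by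
      rw [Finset.card_range]
      exact (degree_le_natDegree).trans_lt (by exact_mod_cast Nat.lt_succ_of_le hq))
  have h1 := hqe 1
  rw [one_smul] at h1
  rw [← h1, h, Lagrange.interpolate_apply, eval_finsetSum]
  refine Finset.sum_congr rfl fun i _ => ?_
  rw [eval_mul, eval_C, hqe, mul_comm]

theorem bijective_add_of_lipschitzWith_lt_one {k : E → E} {c : ℝ≥0} (hk : LipschitzWith c k)
    (hc : c < 1) : Function.Bijective fun x => x + k x := by
  have happ : ApproximatesLinearOn (fun x => x + k x)
      ((ContinuousLinearEquiv.refl ℝ E : E ≃L[ℝ] E) : E →L[ℝ] E) univ c := by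
    rw [ApproximatesLinearOn.approximatesLinearOn_iff_lipschitzOnWith, lipschitzOnWith_univ]
    convert hk using 1
    ext x
    simp
  have hN : Subsingleton E ∨
      c < ‖((ContinuousLinearEquiv.refl ℝ E).symm : E →L[ℝ] E)‖₊⁻¹ := by
    rcases subsingleton_or_nontrivial E with h | h
    · exact Or.inl h
    · right
      have : ‖((ContinuousLinearEquiv.refl ℝ E).symm : E →L[ℝ] E)‖₊ = 1 := by
        ext; exact ContinuousLinearMap.norm_id
      rwa [this, inv_one]
  exact ⟨(injOn_univ).1 (happ.injOn hN), happ.surjective hN⟩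

/-- A small perturbation of the identity that is trivial on the unit sphere permutes the open unit
ball: extended by the identity, it is a bijection of the whole space which fixes the complement. -/
theorem image_ball_add_of_lipschitzOnWith {k : E → E} {c : ℝ≥0} (hc : c < 1)
    (hk : LipschitzOnWith c k (closedBall 0 1)) (h0 : ∀ x, ‖x‖ = 1 → k x = 0) :
    InjOn (fun x => x + k x) (ball 0 1) ∧ (fun x => x + k x) '' ball 0 1 = ball 0 1 := by
  have hb := bijective_add_of_lipschitzWith_lt_one (lipschitzWith_indicator_ball hk h0) hc
  have hin : EqOn (fun x => x + k x) (fun x => x + (ball (0 : E) 1).indicator k x) (ball 0 1) :=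
    fun x hx => by simp only [indicator_of_mem hx]
  refine ⟨hin.injOn_iff.2 hb.1.injOn, ?_⟩
  rw [hin.image_eq, ← compl_inj_iff, ← image_compl_eq hb]
  refine (image_congr fun x hx => ?_).trans (image_id _)
  rw [indicator_of_notMem hx, add_zero, id]

/-- The image of the derivative is orthogonal to `r x`, which is not zero. -/
theorem det_fderiv_eq_zero_of_norm_eq_one {r : E → E} {x : E} (hr : DifferentiableAt ℝ r x)
    (h1 : ∀ᶠ y in nhds x, ‖r y‖ = 1) : (fderiv ℝ r x).det = 0 := by
  by_contra hdet
  have hconst : (fun y => inner ℝ (r y) (r y)) =ᶠ[nhds x] fun _ => (1 : ℝ) := by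
    filter_upwards [h1] with y hy
    rw [real_inner_self_eq_norm_sq, hy, one_pow]
  have h2 := (hr.hasFDerivAt.inner ℝ hr.hasFDerivAt).unique
    ((hasFDerivAt_const (1 : ℝ) x).congr_of_eventuallyEq hconst)
  obtain ⟨v, hv⟩ := (LinearMap.equivOfDetNeZero _ hdet).surjective (r x)
  have h3 := congrArg (fun T => T v) h2
  have hv' : fderiv ℝ r x v = r x := hv
  simp [hv', h1.self_of_nhds] at h3

/-- There is no `C¹` retraction of the closed unit ball onto its sphere. This includes dimension
zero, where the sphere is empty. -/
theorem not_contDiffAt_retraction (r : E → E) (hr : ∀ x ∈ closedBall (0 : E) 1, ContDiffAt ℝ 1 r x)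
    (h1 : ∀ x ∈ closedBall (0 : E) 1, ‖r x‖ = 1) (hid : ∀ x, ‖x‖ = 1 → r x = x) : False := by
  borelize E
  let μ : Measure E := Measure.addHaar
  set k : E → E := fun x => r x - x with hkdef
  have hk : ∀ x ∈ closedBall (0 : E) 1, ContDiffAt ℝ 1 k x := fun x hx =>
    (hr x hx).sub contDiffAt_id
  have hk0 : ∀ x, ‖x‖ = 1 → k x = 0 := fun x hx => by simp [hkdef, hid x hx]
  have hcont : ContinuousOn (fderiv ℝ k) (closedBall 0 1) := fun x hx =>
    ((hk x hx).continuousAt_fderiv (by simp)).continuousWithinAt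
  have hcpt : IsCompact (closedBall (0 : E) 1) := isCompact_closedBall _ _
  obtain ⟨L, hL⟩ := hcpt.exists_bound_of_continuousOn hcont
  have hL0 : 0 ≤ L := (norm_nonneg _).trans (hL 0 (by simp))
  have hLip : LipschitzOnWith (Real.toNNReal L) k (closedBall 0 1) :=
    (convex_closedBall _ _).lipschitzOnWith_of_nnnorm_fderiv_le
      (fun x hx => (hk x hx).differentiableAt (by simp))
      (fun x hx => NNReal.le_toNNReal_of_coe_le (hL x hx))
  have hdetc : Continuous fun M : E →L[ℝ] E => M.det := ContinuousLinearMap.continuous_det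
  obtain ⟨δ, hδ, hδd⟩ : ∃ δ > 0, ∀ M : E →L[ℝ] E, ‖M‖ < δ →
      0 < (ContinuousLinearMap.id ℝ E + M).det := by
    have hop : ∀ᶠ M in nhds (0 : E →L[ℝ] E), 0 < (ContinuousLinearMap.id ℝ E + M).det := by
      refine (hdetc.comp (continuous_const.add continuous_id)).continuousAt.eventually_const_lt ?_
      simp [ContinuousLinearMap.det]
    obtain ⟨δ, hδ, h⟩ := Metric.eventually_nhds_iff.1 hop
    exact ⟨δ, hδ, fun M hM => h (by simpa using hM)⟩
  -- For small `t` the map `x ↦ x + t • k x` permutes the ball with positive Jacobian determinant,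
  -- so the integral of that determinant is the volume of the ball.
  have hsmall : ∀ t : ℝ, 0 ≤ t → t * L < 1 → t * L < δ →
      ∫ x in ball (0 : E) 1, (ContinuousLinearMap.id ℝ E + t • fderiv ℝ k x).det ∂μ =
        μ.real (ball 0 1) := by
    intro t ht htL htδ
    have hLt : LipschitzOnWith (Real.toNNReal (t * L)) (fun x => t • k x) (closedBall 0 1) := by
      refine LipschitzOnWith.of_dist_le_mul fun x hx y hy => ?_
      rw [dist_smul₀, Real.norm_of_nonneg ht, Real.coe_toNNReal _ (by positivity), mul_assoc]
      have := hLip.dist_le_mul x hx y hy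
      rw [Real.coe_toNNReal _ hL0] at this
      gcongr
    obtain ⟨hinj, himg⟩ := image_ball_add_of_lipschitzOnWith
      (by rwa [Real.toNNReal_lt_one]) hLt (fun x hx => by simp [hk0 x hx])
    have hder : ∀ x ∈ ball (0 : E) 1, HasFDerivWithinAt (fun x => x + t • k x)
        (ContinuousLinearMap.id ℝ E + t • fderiv ℝ k x) (ball 0 1) x := fun x hx =>
      ((hasFDerivAt_id x).add ((((hk x (ball_subset_closedBall hx)).differentiableAt
        (by simp)).hasFDerivAt).const_smul t)).hasFDerivWithinAt
    have := integral_image_eq_integral_abs_det_fderiv_smul μ measurableSet_ball hder hinj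
      (fun _ => (1 : ℝ))
    rw [himg] at this
    rw [setIntegral_const, smul_eq_mul, mul_one] at this
    rw [this]
    refine setIntegral_congr_fun measurableSet_ball fun x hx => ?_
    have : 0 < (ContinuousLinearMap.id ℝ E + t • fderiv ℝ k x).det := by
      refine hδd _ (lt_of_le_of_lt ?_ htδ)
      rw [norm_smul, Real.norm_of_nonneg ht]
      gcongr
      exact hL x (ball_subset_closedBall hx)
    simp only [abs_of_pos this, smul_eq_mul, mul_one]
  obtain ⟨ε, hε, hε1, hεδ⟩ : ∃ ε > 0, ε * L < 1 ∧ ε * L < δ := by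
    refine ⟨min 1 δ / (2 * (L + 1)), by positivity, ?_, ?_⟩
    all_goals
      have h2 : min 1 δ / (2 * (L + 1)) * L < min 1 δ := by
        rw [div_mul_eq_mul_div, div_lt_iff₀ (by positivity)]
        nlinarith [lt_min one_pos hδ]
    · exact h2.trans_le (min_le_left _ _)
    · exact h2.trans_le (min_le_right _ _)
  -- Nodes in `(0, ε]`, where the integral is already known.
  set v : ℕ → ℝ := fun i => ε / (i + 1) with hv
  have hvinj : Function.Injective v := fun i j hij => by
    have : (i : ℝ) + 1 = j + 1 := by
      simp only [hv] at hij
      field_simp at hij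
      linarith
    exact_mod_cast add_right_cancel this
  have hv0 : ∀ i, 0 ≤ v i := fun i => by positivity
  have hvε : ∀ i, v i * L ≤ ε * L := fun i => by
    gcongr
    exact div_le_self hε.le (by simp)
  obtain ⟨c, hc⟩ := exists_sum_mul_det_eq_det_one_add (E := E) v hvinj
  have hint : ∀ t : ℝ, IntegrableOn
      (fun x => (ContinuousLinearMap.id ℝ E + t • fderiv ℝ k x).det) (ball 0 1) μ := fun t =>
    ((hdetc.comp_continuousOn (continuousOn_const.add (hcont.const_smul t))).integrableOn_compact
      hcpt).mono_set ball_subset_closedBall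
  have hsum : ∫ x in ball (0 : E) 1, (ContinuousLinearMap.id ℝ E + fderiv ℝ k x).det ∂μ =
      μ.real (ball 0 1) := by
    rw [integral_congr_ae (Filter.Eventually.of_forall fun x => hc (fderiv ℝ k x))]
    rw [integral_finsetSum _ fun i _ => (hint (v i)).const_mul _]
    simp_rw [integral_const_mul]
    -- The interpolation formula at `A = 0` says that the weights sum to `1`.
    have hc0 : 1 = ∑ i ∈ Finset.range (Module.finrank ℝ E + 1), c i := by
      simpa only [smul_zero, add_zero, ContinuousLinearMap.det, ContinuousLinearMap.coe_id,
        LinearMap.det_id, mul_one] using hc 0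
    rw [Finset.sum_congr rfl fun i _ => by
      rw [hsmall (v i) (hv0 i) ((hvε i).trans_lt hε1) ((hvε i).trans_lt hεδ)],
      ← Finset.sum_mul, ← hc0, one_mul]
  have hzero : ∫ x in ball (0 : E) 1, (ContinuousLinearMap.id ℝ E + fderiv ℝ k x).det ∂μ = 0 := by
    refine setIntegral_eq_zero_of_forall_eq_zero fun x hx => ?_
    have hd := (hr x (ball_subset_closedBall hx)).differentiableAt (by simp)
    have : ContinuousLinearMap.id ℝ E + fderiv ℝ k x = fderiv ℝ r x := by
      rw [hkdef, fderiv_fun_sub hd differentiableAt_fun_id, fderiv_fun_id]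
      abel
    rw [this]
    refine det_fderiv_eq_zero_of_norm_eq_one hd ?_
    filter_upwards [isOpen_ball.mem_nhds hx] with y hy using h1 y (ball_subset_closedBall hy)
  have hpos : 0 < μ.real (ball (0 : E) 1) :=
    ENNReal.toReal_pos (measure_ball_pos μ 0 one_pos).ne' measure_ball_lt_top.ne
  linarith [hsum.symm.trans hzero]

end NoRetraction


/-! ### Brouwer's theorem on the Euclidean ball -/

section BallFixedPoint

open Set Metric

variable {E : Type*} [NormedAddCommGroup E] [InnerProductSpace ℝ E] [FiniteDimensional ℝ E]

/-- Without fixed points, sending `x` to the point where the ray from `g x` through `x` leaves the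
ball would be a `C¹` retraction onto the sphere. -/
theorem exists_fixedPoint_of_contDiff {g : E → E} (hg : ContDiff ℝ 1 g)
    (hlt : ∀ x ∈ closedBall (0 : E) 1, ‖g x‖ < 1) : ∃ x ∈ closedBall (0 : E) 1, g x = x := by
  by_contra! hne
  set a : E → ℝ := fun x => ‖x - g x‖ ^ 2 with ha
  set b : E → ℝ := fun x => inner ℝ x (x - g x) with hb
  set D : E → ℝ := fun x => b x ^ 2 + a x * (1 - ‖x‖ ^ 2) with hD
  have ha0 : ∀ x ∈ closedBall (0 : E) 1, 0 < a x := fun x hx =>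
    pow_pos (norm_pos_iff.2 (sub_ne_zero.2 (hne x hx).symm)) 2
  have hb0 : ∀ x, ‖x‖ = 1 → 0 < b x := fun x hx => by
    have h1 := hlt x (by simp [hx])
    have h2 := real_inner_le_norm x (g x)
    simp only [hb, inner_sub_right, real_inner_self_eq_norm_sq, hx, one_pow]
    rw [hx, one_mul] at h2
    linarith
  have hD0 : ∀ x ∈ closedBall (0 : E) 1, 0 < D x := fun x hx => by
    have hx1 : ‖x‖ ≤ 1 := by simpa using hx
    rcases hx1.lt_or_eq with h | h
    · have h3 : 0 < 1 - ‖x‖ ^ 2 := by nlinarith [norm_nonneg x]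
      have := mul_pos (ha0 x hx) h3
      simp only [hD]
      positivity
    · simp only [hD, h]
      have := hb0 x h
      norm_num
      positivity
  have hac : ContDiff ℝ 1 a := (contDiff_id.sub hg).norm_sq ℝ
  have hbc : ContDiff ℝ 1 b := contDiff_id.inner ℝ (contDiff_id.sub hg)
  have hDc : ContDiff ℝ 1 D := (hbc.pow 2).add (hac.mul (contDiff_const.sub (contDiff_id.norm_sq ℝ)))
  -- `(-b x + √(D x)) / a x` is the larger root `t` of `‖x + t • (x - g x)‖ = 1`; `D` is positive also
  -- on the sphere because `‖g x‖ < 1`, so the square root is smooth there.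
  refine not_contDiffAt_retraction (fun x => x + ((-b x + √(D x)) / a x) • (x - g x))
    (fun x hx => ?_) (fun x hx => ?_) (fun x hx => ?_)
  · exact contDiffAt_id.add (((hbc.contDiffAt.neg.add (hDc.contDiffAt.sqrt (hD0 x hx).ne')).div
      hac.contDiffAt (ha0 x hx).ne').smul (contDiff_id.sub hg).contDiffAt)
  · rw [← sq_eq_sq₀ (norm_nonneg _) zero_le_one, norm_add_sq_real, inner_smul_right, norm_smul,
      mul_pow, Real.norm_eq_abs, sq_abs]
    change ‖x‖ ^ 2 + 2 * ((-b x + √(D x)) / a x * b x) + ((-b x + √(D x)) / a x) ^ 2 * a x = _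
    have h1 := (ha0 x hx).ne'
    have h2 := Real.sq_sqrt (hD0 x hx).le
    field_simp
    have h3 : D x = b x ^ 2 + a x * (1 - ‖x‖ ^ 2) := rfl
    linear_combination h2 + h3
  · have h1 : D x = b x ^ 2 := by simp [hD, hx]
    simp [h1, Real.sqrt_sq (hb0 x hx).le]

/-- **Brouwer's fixed point theorem** for the closed unit ball of a Euclidean space. -/
theorem exists_fixedPoint_closedBall {f : E → E} (hf : Continuous f)
    (hle : ∀ x ∈ closedBall (0 : E) 1, ‖f x‖ ≤ 1) : ∃ x ∈ closedBall (0 : E) 1, f x = x := by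
  by_contra! hne
  obtain ⟨x₀, hx₀, hmin⟩ := (isCompact_closedBall (0 : E) 1).exists_isMinOn ⟨0, by simp⟩
    (f := fun x => ‖f x - x‖) (by fun_prop)
  set ε := ‖f x₀ - x₀‖ / 2 with hε
  have hε0 : 0 < ε := half_pos (norm_pos_iff.2 (sub_ne_zero.2 (hne x₀ hx₀)))
  obtain ⟨g, hg, hgf, -⟩ := hf.exists_contDiff_approx 1 (ε := fun _ => ε) continuous_const
    (fun _ => hε0)
  have hε1 : 0 < 1 + ε := by positivity
  -- The factor `(1 + ε)⁻¹` brings the smooth approximation back into the open ball.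
  obtain ⟨x, hx, hgx⟩ := exists_fixedPoint_of_contDiff (g := fun x => (1 + ε)⁻¹ • g x)
    ((hg.of_le (by simp)).const_smul _) (fun x hx => by
      rw [norm_smul, Real.norm_of_nonneg (by positivity), inv_mul_lt_one₀ hε1]
      have h1 := hgf x
      rw [dist_eq_norm] at h1
      linarith [norm_le_norm_add_norm_sub' (g x) (f x), hle x hx])
  have hgx' : g x = (1 + ε) • x := by
    rw [← hgx, smul_smul, mul_inv_cancel₀ hε1.ne', one_smul, hgx]
  have h1 := hgf x
  rw [dist_eq_norm, norm_sub_rev] at h1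
  have h2 : ‖g x - x‖ ≤ ε := by
    rw [hgx', add_smul, one_smul, add_sub_cancel_left, norm_smul, Real.norm_of_nonneg hε0.le]
    exact mul_le_of_le_one_right hε0.le (by simpa using hx)
  have h3 : ‖f x₀ - x₀‖ ≤ ‖f x - x‖ := hmin hx
  linarith [norm_sub_le_norm_sub_add_norm_sub (f x) (g x) x]

end BallFixedPoint

/-! ### Brouwer's theorem on the standard simplex -/

section Simplex

open Set

variable {ι : Type*} [Fintype ι]

/-- A retraction of `ι → ℝ` onto the standard simplex: take positive parts, spread what is missing
to the sum `1` equally over the coordinates, and divide by the sum if it exceeds `1`. -/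
noncomputable def simplexRetraction (x : ι → ℝ) (i : ι) : ℝ :=
  (max (x i) 0 + max (1 - ∑ j, max (x j) 0) 0 / Fintype.card ι) / max (∑ j, max (x j) 0) 1

theorem continuous_simplexRetraction : Continuous (simplexRetraction (ι := ι)) := by
  unfold simplexRetraction
  refine continuous_pi fun i => Continuous.div (by fun_prop) (by fun_prop) fun x => ?_
  positivity

theorem simplexRetraction_mem_stdSimplex [Nonempty ι] (x : ι → ℝ) :
    simplexRetraction x ∈ stdSimplex ℝ ι := by
  refine ⟨fun i => by unfold simplexRetraction; positivity, ?_⟩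
  simp only [simplexRetraction]
  rw [← Finset.sum_div, Finset.sum_add_distrib, Finset.sum_const, Finset.card_univ, nsmul_eq_mul,
    mul_div_cancel₀ _ (by simp), div_eq_one_iff_eq (by positivity)]
  rcases le_total (∑ j, max (x j) 0) 1 with h | h
  · rw [max_eq_left (by linarith), max_eq_right h]; ring
  · rw [max_eq_right (by linarith), max_eq_left h, add_zero]

theorem simplexRetraction_eq_self {x : ι → ℝ} (hx : x ∈ stdSimplex ℝ ι) :
    simplexRetraction x = x := by
  ext i
  have h : ∑ j, max (x j) 0 = 1 := by
    rw [← hx.2]; exact Finset.sum_congr rfl fun j _ => max_eq_left (hx.1 j)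
  simp [simplexRetraction, h, hx.1 i]

theorem norm_toLp_le_one_of_mem_stdSimplex {x : ι → ℝ} (hx : x ∈ stdSimplex ℝ ι) :
    ‖WithLp.toLp 2 x‖ ≤ 1 := by
  rw [EuclideanSpace.norm_eq, Real.sqrt_le_iff, one_pow]
  refine ⟨zero_le_one, ?_⟩
  rw [← hx.2]
  refine Finset.sum_le_sum fun i _ => ?_
  have h1 : x i ≤ 1 := hx.2 ▸ Finset.single_le_sum (fun j _ => hx.1 j) (Finset.mem_univ i)
  rw [Real.norm_of_nonneg (hx.1 i)]
  exact pow_le_of_le_one (hx.1 i) h1 two_ne_zero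

/-- **Brouwer's fixed point theorem** for the standard simplex. -/
theorem exists_fixedPoint_stdSimplex [Nonempty ι] {f : (ι → ℝ) → ι → ℝ}
    (hf : ContinuousOn f (stdSimplex ℝ ι)) (hmap : MapsTo f (stdSimplex ℝ ι) (stdSimplex ℝ ι)) :
    ∃ x ∈ stdSimplex ℝ ι, f x = x := by
  have hc : Continuous fun x : ι → ℝ => f (simplexRetraction x) :=
    hf.comp_continuous continuous_simplexRetraction simplexRetraction_mem_stdSimplex
  obtain ⟨x, -, hx⟩ := exists_fixedPoint_closedBall
    (f := fun x : EuclideanSpace ℝ ι => WithLp.toLp 2 (f (simplexRetraction (WithLp.ofLp x))))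
    ((PiLp.continuous_toLp 2 _).comp (hc.comp (PiLp.continuous_ofLp 2 _)))
    (fun x _ => norm_toLp_le_one_of_mem_stdSimplex (hmap (simplexRetraction_mem_stdSimplex _)))
  have hx' : f (simplexRetraction (WithLp.ofLp x)) = WithLp.ofLp x := congrArg WithLp.ofLp hx
  have hmem : WithLp.ofLp x ∈ stdSimplex ℝ ι :=
    hx' ▸ hmap (simplexRetraction_mem_stdSimplex _)
  exact ⟨_, hmem, by rwa [simplexRetraction_eq_self hmem] at hx'⟩

end Simplex

/-! ### Fixed points in locally convex spaces -/

section LocallyConvex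

open Set Topology

variable {X : Type*} [AddCommGroup X] [Module ℝ X] [TopologicalSpace X]
  [IsTopologicalAddGroup X] [ContinuousSMul ℝ X]

/-- Approximate fixed points. Points `i` of a finite set `T ⊆ C` with `C ⊆ T + V` carry the weights
`w i y`, which vanish unless `y - i ∈ V`, so the barycentre of `T` with these weights differs from
`y` by an element of `V`. Brouwer's theorem is applied to the barycentric coordinates. -/
theorem exists_sub_mem_of_mapsTo {C : Set X} (hC : IsCompact C) (hconv : Convex ℝ C)
    (hne : C.Nonempty) {f : X → X} (hf : ContinuousOn f C) (hmap : MapsTo f C C)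
    {V : Set X} (hV : Convex ℝ V) (hVo : IsOpen V) (hV0 : (0 : X) ∈ V) :
    ∃ x ∈ C, f x - x ∈ V := by
  obtain ⟨T, hTC, hT⟩ := hC.elim_nhds_subcover (fun x => {y | y - x ∈ V}) fun x _ =>
    (hVo.preimage (continuous_id.sub continuous_const)).mem_nhds (by simpa using hV0)
  have hTne : Nonempty T := by
    obtain ⟨x, hx⟩ := hne
    obtain ⟨y, hy, -⟩ := mem_iUnion₂.1 (hT hx)
    exact ⟨⟨y, hy⟩⟩
  let w : T → X → ℝ := fun i y => max (1 - gauge V (y - i)) 0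
  have hwc : ∀ i, Continuous (w i) := fun i =>
    (continuous_const.sub ((continuous_gauge hV (hVo.mem_nhds hV0)).comp
      (continuous_id.sub continuous_const))).max continuous_const
  have hw0 : ∀ i y, 0 ≤ w i y := fun i y => le_max_right _ _
  have hwV : ∀ i y, w i y ≠ 0 → y - i ∈ V := fun i y h => by
    by_contra hy
    refine h (max_eq_right (sub_nonpos.2 (one_le_gauge_of_notMem ?_ ?_ hy)))
    · exact hV.starConvex hV0
    · exact absorbent_nhds_zero (hVo.mem_nhds hV0) _
  have hwsum : ∀ y ∈ C, 0 < ∑ i, w i y := fun y hy => by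
    obtain ⟨x, hx, hyx⟩ := mem_iUnion₂.1 (hT hy)
    refine Finset.sum_pos' (fun i _ => hw0 i y) ⟨⟨x, hx⟩, Finset.mem_univ _, ?_⟩
    exact lt_max_of_lt_left (sub_pos.2 (gauge_lt_one_of_mem_of_isOpen hVo hyx))
  let z : (T → ℝ) → X := fun s => ∑ i, s i • (i : X)
  have hzc : Continuous z := by fun_prop
  have hzC : MapsTo z (stdSimplex ℝ T) C := fun s hs =>
    hconv.sum_mem (fun i _ => hs.1 i) hs.2 fun i _ => hTC i i.2
  obtain ⟨s, hs, hfix⟩ := exists_fixedPoint_stdSimplex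
    (f := fun s i => w i (f (z s)) / ∑ j, w j (f (z s)))
    (continuousOn_pi.2 fun i => by
      have hfz : ContinuousOn (fun s => f (z s)) (stdSimplex ℝ T) :=
        hf.comp hzc.continuousOn hzC
      exact ((hwc i).comp_continuousOn hfz).div
        (continuousOn_finsetSum _ fun j _ => (hwc j).comp_continuousOn hfz)
        fun s hs => (hwsum _ (hmap (hzC hs))).ne')
    (fun s hs => ⟨fun i => div_nonneg (hw0 _ _) (Finset.sum_nonneg fun j _ => hw0 _ _), by
      rw [← Finset.sum_div, div_self (hwsum _ (hmap (hzC hs))).ne']⟩)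
  refine ⟨z s, hzC hs, ?_⟩
  have hsum : f (z s) - z s = ∑ i : T, s i • (if w i (f (z s)) = 0 then 0 else f (z s) - i) := by
    have h1 : f (z s) - z s = ∑ i : T, s i • (f (z s) - (i : X)) := by
      simp_rw [smul_sub, Finset.sum_sub_distrib, ← Finset.sum_smul, hs.2, one_smul]
      rfl
    rw [h1]
    refine Finset.sum_congr rfl fun i _ => ?_
    split_ifs with h
    · rw [← congrFun hfix i, h, zero_div, zero_smul, zero_smul]
    · rfl
  rw [hsum]
  refine hV.sum_mem (fun i _ => hs.1 i) hs.2 fun i _ => ?_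
  split_ifs with h
  · exact hV0
  · exact hwV i _ h

variable [T2Space X]

/-- The **Schauder–Tychonoff fixed point theorem**. -/
theorem exists_fixedPoint_of_isCompact_convex [LocallyConvexSpace ℝ X] {C : Set X}
    (hC : IsCompact C) (hconv : Convex ℝ C) (hne : C.Nonempty) {f : X → X}
    (hf : ContinuousOn f C) (hmap : MapsTo f C C) : ∃ x ∈ C, f x = x := by
  by_contra! h
  have hcl : IsClosed ((fun x => f x - x) '' C) :=
    (hC.image_of_continuousOn (hf.sub continuousOn_id)).isClosed
  have h0 : ((fun x => f x - x) '' C)ᶜ ∈ 𝓝 (0 : X) :=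
    hcl.isOpen_compl.mem_nhds fun ⟨x, hx, hx0⟩ => h x hx (sub_eq_zero.1 hx0)
  obtain ⟨V, ⟨hV0, hVo, hV⟩, hVU⟩ :=
    (LocallyConvexSpace.convex_open_basis_zero ℝ X).mem_iff.1 h0
  obtain ⟨x, hx, hxV⟩ := exists_sub_mem_of_mapsTo hC hconv hne hf hmap hV hVo hV0
  exact hVU hxV ⟨x, hx, rfl⟩

end LocallyConvex

/-! ### The closed convex hull of a star-shaped set of positive convexity index -/

section ConvexityIndex

open Set
open scoped ENNReal

theorem starGauge_le_inv_convexityIndex {X : Type*} [AddCommGroup X] [Module ℝ X]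
    [TopologicalSpace X] {S : Set X} {p x : X}
    (hx : x ∈ closure (convexHull ℝ S)) :
    starGauge S p x ≤ (convexityIndex S p)⁻¹ := by
  have hC : starGauge (closure (convexHull ℝ S)) p x ≤ 1 :=
    sInf_le ⟨1, one_pos, ⟨x, hx, by simp⟩, by simp⟩
  rcases eq_or_ne (starGauge S p x) 0 with h0 | h0
  · simp [h0]
  · have h1 : convexityIndex S p ≤ extRatio _ _ := iInf₂_le x hx
    rw [extRatio, if_neg fun h => h0 h.2] at h1
    refine ENNReal.le_inv_iff_le_inv.1 (h1.trans ?_)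
    rw [← one_div]
    gcongr

variable {X : Type*} [AddCommGroup X] [Module ℝ X] [TopologicalSpace X]
  [IsTopologicalAddGroup X] [ContinuousSMul ℝ X] [T2Space X]

/-- The homothety with centre `p` and ratio the convexity index maps the closed convex hull of `S`
into `S`. -/
theorem add_smul_sub_mem_of_mem_closure_convexHull {S : Set X} (hS : IsCompact S) {p : X}
    (hstar : StarConvex ℝ p S) (hα : 0 < convexityIndex S p) (hα' : convexityIndex S p ≠ ∞) {x : X}
    (hx : x ∈ closure (convexHull ℝ S)) :
    p + (convexityIndex S p).toReal • (x - p) ∈ S := by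
  set a := (convexityIndex S p).toReal with ha
  have ha0 : 0 < a := ENNReal.toReal_pos hα.ne' hα'
  have hcl : IsClosed {s : ℝ | p + s • (x - p) ∈ S} :=
    hS.isClosed.preimage (by fun_prop)
  -- The gauge need not be attained, so factors `s < a` come first and `s = a` follows as `S` is closed.
  have hsub : Ioo 0 a ⊆ {s : ℝ | p + s • (x - p) ∈ S} := by
    rintro s ⟨hs0, hsa⟩
    have h1 : starGauge S p x < ENNReal.ofReal s⁻¹ := by
      refine (starGauge_le_inv_convexityIndex hx).trans_lt ?_
      rw [ENNReal.ofReal_inv_of_pos hs0, ENNReal.inv_lt_inv]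
      exact (ENNReal.ofReal_lt_iff_lt_toReal hs0.le hα').2 hsa
    obtain ⟨_, ⟨r, hr, ⟨y, hy, hxy⟩, rfl⟩, hrs⟩ := sInf_lt_iff.1 h1
    have hrs' : r < s⁻¹ := (ENNReal.ofReal_lt_ofReal_iff (inv_pos.2 hs0)).1 hrs
    have hsr : s * r ≤ 1 := by
      rw [← mul_inv_cancel₀ hs0.ne']
      exact mul_le_mul_of_nonneg_left hrs'.le hs0.le
    rw [mem_ofPred_eq, hxy, smul_smul]
    exact hstar.add_smul_sub_mem hy (by positivity) hsr
  have := closure_minimal hsub hcl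
  rw [closure_Ioo ha0.ne] at this
  exact this ⟨ha0.le, le_rfl⟩

/-- The closed convex hull is a closed subset of a homothetic copy of `S`. No completeness of `X` is
needed. -/
theorem isCompact_closure_convexHull_of_convexityIndex_pos {S : Set X} (hS : IsCompact S) {p : X}
    (hstar : StarConvex ℝ p S) (hα : 0 < convexityIndex S p) (hα' : convexityIndex S p ≠ ∞) :
    IsCompact (closure (convexHull ℝ S)) := by
  have ha0 : 0 < (convexityIndex S p).toReal := ENNReal.toReal_pos hα.ne' hα'
  have hcont : Continuous fun y : X => p + (convexityIndex S p).toReal⁻¹ • (y - p) := by fun_prop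
  refine (hS.image hcont).of_isClosed_subset isClosed_closure fun x hx =>
    ⟨_, add_smul_sub_mem_of_mem_closure_convexHull hS hstar hα hα' hx, ?_⟩
  simp [smul_smul, inv_mul_cancel₀ ha0.ne']

end ConvexityIndex

/-! ### Points mapped to multiples of themselves -/

theorem theorem3p1 {X : Type*} [AddCommGroup X] [Module ℝ X] [TopologicalSpace X]
    [IsTopologicalAddGroup X] [ContinuousSMul ℝ X] [LocallyConvexSpace ℝ X] [T2Space X]
    (S : Set X) (hS : IsCompact S) (p : X) (hp : p ∈ S) (hstar : StarConvex ℝ p S)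
    (hα : 0 < convexityIndex S p) (f : S → S) (hf : Continuous f) :
    f ⟨p, hp⟩ = ⟨p, hp⟩ ∨
      ∃ x : Set.Ioc (0 : ℝ) 1 → S, Function.Injective x ∧
        ∀ t : Set.Ioc (0 : ℝ) 1,
          (f (x t) : X) =
            p + (1 / ((t : ℝ) * (convexityIndex S p).toReal)) • ((x t : X) - p) := by
  have hα' : convexityIndex S p ≠ ⊤ :=
    ((convexityIndex_le_one hp).trans_lt ENNReal.one_lt_top).ne
  set a := (convexityIndex S p).toReal with ha
  have ha0 : 0 < a := ENNReal.toReal_pos hα.ne' hα'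
  set C := closure (convexHull ℝ S) with hCdef
  have hCS : S ⊆ C := (subset_convexHull ℝ S).trans subset_closure
  have hshrink : ∀ t : Set.Ioc (0 : ℝ) 1, ∀ y ∈ C, p + ((t : ℝ) * a) • (y - p) ∈ S := by
    intro t y hy
    have h := hstar.add_smul_sub_mem
      (add_smul_sub_mem_of_mem_closure_convexHull hS hstar hα hα' hy) t.2.1.le t.2.2
    rwa [add_sub_cancel_left, smul_smul] at h
  obtain ⟨F, hF⟩ : ∃ F : X → X, ∀ z : S, F z = f z :=
    ⟨Function.extend Subtype.val (fun z => (f z : X)) id,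
      fun z => Subtype.val_injective.extend_apply _ _ z⟩
  have hFc : ContinuousOn F S := by
    rw [continuousOn_iff_continuous_domRestrict]
    exact (continuous_subtype_val.comp hf).congr fun z => (hF z).symm
  have hfix : ∀ t : Set.Ioc (0 : ℝ) 1, ∃ y ∈ C, F (p + ((t : ℝ) * a) • (y - p)) = y := fun t =>
    exists_fixedPoint_of_isCompact_convex
      (isCompact_closure_convexHull_of_convexityIndex_pos hS hstar hα hα')
      (convex_convexHull ℝ S).closure ⟨p, hCS hp⟩
      (hFc.comp (by fun_prop) (hshrink t))
      fun y hy => hCS (by rw [hF ⟨_, hshrink t y hy⟩]; exact Subtype.coe_prop _)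
  choose y hyC hy using hfix
  let x : Set.Ioc (0 : ℝ) 1 → S := fun t => ⟨_, hshrink t (y t) (hyC t)⟩
  have hx : ∀ t : Set.Ioc (0 : ℝ) 1,
      (f (x t) : X) = p + (1 / ((t : ℝ) * a)) • ((x t : X) - p) := fun t => by
    have hta : (t : ℝ) * a ≠ 0 := (mul_pos t.2.1 ha0).ne'
    rw [← hF, hy t, add_sub_cancel_left, smul_smul, one_div, inv_mul_cancel₀ hta, one_smul,
      add_sub_cancel]
  -- If `x t = x u` with `t ≠ u`, the two formulas for `f (x t)` force `x t = p`, hence `f p = p`.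
  refine or_iff_not_imp_left.2 fun hpf => ⟨x, fun t u htu => ?_, hx⟩
  by_contra hne
  have h1 : (1 / ((t : ℝ) * a)) • ((x t : X) - p) = (1 / ((u : ℝ) * a)) • ((x t : X) - p) := by
    have h2 := hx u
    rw [← htu, hx t] at h2
    exact add_left_cancel h2
  have h3 : (x t : X) - p = 0 := by
    by_contra h0
    have h4 := smul_left_injective ℝ h0 h1
    rw [one_div, one_div, inv_inj] at h4
    exact hne (Subtype.ext (mul_right_cancel₀ ha0.ne' h4))
  have hxp : x t = ⟨p, hp⟩ := Subtype.ext (sub_eq_zero.1 h3)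
  refine hpf (Subtype.ext ?_)
  rw [← hxp, hx t, h3, smul_zero, add_zero, hxp]
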